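/- **Setting.** Let $\mathbb S$ be a compact Polish space and $\mathbb O=\mathbb R^p$. Let $(X_t,Y_t)_{t\ge 0}$ be the canonical process on the space $\Omega=D([0,\infty);\mathbb S)\times D([0,\infty);\mathbb O)$ of pairs of càdlàg paths, with its $\sigma$-algebra generated by the coordinates. Let $\{\mathbf P_{(x,y)}\}$ be a measurable family of probability measures on $\Omega$ under which $(X_t,Y_t)$ is a time-homogeneous Feller–Markov process started at $(x,y)$, and such that $X_t$ is a Feller–Markov process in its own right. For $\nu\in\mathcal P(\mathbb S\times\mathbb O)$ put $\mathbf P_\nu=\int\mathbf P_{(x,y)}\,\nu(dx,dy)$, and for $\mu\in\mathcal P(\mathbb S)$ put $\mathbf P^\mu=\mathbf P_{\mu\times\delta_0}$. Write $\mu\backsim\nu$ if $\mathbf P^\mu$ and $\mathbf P^\nu$ agree on $\mathscr F^Y=\sigma\{Y_t:t\ge0\}$; the model is *observable* if $\mu\backsim\nu$ implies $\mu=\nu$. Let $$\mathcal N=\{\alpha\mu_1-\alpha\mu_2:\ \alpha\in\mathbb R,\ \mu_1,\mu_2\in\mathcal P(\mathbb S),\ \mu_1\backsim\mu_2\}$$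 be the space of nonobservable (signed) measures and $$\mathcal O=\{f\in\mathcal C_b(\mathbb S):\ \mu_1(f)=\mu_2(f)\text{ for all }\mu_1\backsim\mu_2\}$$ the space of observable functions. For a continuous $h:\mathbb S\to\mathbb O$ let $\mathscr G^h=\sigma\{h(X_t):t\ge0\}$. *White noise type observations:* $Y_t=Y_0+\int_0^t h(X_s)\,ds+KB_t$, where $h$ is continuous, $K$ is a non-random, possibly degenerate $p\times q$ matrix and, under every $\mathbf P_\nu$, $KB$ is a $p$-dimensional Wiener process with covariance matrix $KK^*$ independent of $(X,Y_0)$. *Counting observations:* $Y_t=Y_0+N_t$, where $h$ is continuous with nonnegative components and, for every $\nu$, $N$ is a Cox process with intensity $h(X_t)$: under a regular conditional probability $\mathbf P_\nu(\,\cdot\,|\mathscr F^X)$, $\mathscr F^X=\sigma\{X_t:t\ge0\}$, the components $N^i$ are independent Poisson processes with intensities $h^i(X_t)$, and $N$ is independent of $Y_0$. **Proposition.** 1. In the white noise type observation model, for all $\mu_1,\mu_2\in\mathcal P(\mathbb S)$, $\mu_1\backsim\mu_2$ if and only if $\mathbf P^{\mu_1}|_{\mathscr G^h}=\mathbf P^{\mu_2}|_{\mathscr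 G^h}$, and $$\mathcal N=\{\alpha\mu_1-\alpha\mu_2:\ \alpha\in\mathbb R,\ \mu_1,\mu_2\in\mathcal P(\mathbb S),\ \mathbf P^{\mu_1}|_{\mathscr G^h}=\mathbf P^{\mu_2}|_{\mathscr G^h}\}.$$ 2. Consequently, observability depends only on the laws of the process $h(X_t)$ and not on the noise covariance: if two white noise type observation models with the same $\mathbb S$ and $p$ (with arbitrary noise matrices $K$ and $K'$, of possibly different numbers of columns, and observation functions $h$ and $h'$) are such that, for every $\mu\in\mathcal P(\mathbb S)$, the process $(h(X_t))_{t\ge0}$ in the first model and the process $(h'(X_t))_{t\ge0}$ in the second have the same law when $X_0\sim\mu$ and $Y_0=0$ (for instance, the same signal and $h=h'$), then the two models have the same relation $\backsim$ and the same spaces $\mathcal N$ and $\mathcal O$, and one is observable if and only if the other is. 3. The conclusion of part 1 holds identically for the counting observation model. -/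

import Mathlib

open MeasureTheory ProbabilityTheory Filter Topology Set
open scoped NNReal ENNReal ZeroAtInfty BoundedContinuousFunction

noncomputable section

/-- The space of càdlàg paths `[0, ∞) → E`: right-continuous with left limits.
(At `t = 0` the filter `𝓝[<] t` is trivial, so no left limit is required there.) -/
def CadlagPath (E : Type*) [TopologicalSpace E] : Type _ :=
  {x : ℝ≥0 → E // ∀ t, ContinuousWithinAt x (Ici t) t ∧ ∃ l, Tendsto x (𝓝[<] t) (𝓝 l)}

/-- The path space carries the σ-algebra generated by the coordinate maps `x ↦ x t`; for a Polish
space `E` this is the Borel σ-algebra of the Skorokhod topology. -/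
instance CadlagPath.instMeasurableSpace (E : Type*) [TopologicalSpace E] [MeasurableSpace E] :
    MeasurableSpace (CadlagPath E) :=
  ⨆ t : ℝ≥0, MeasurableSpace.comap (fun x : CadlagPath E => x.1 t) inferInstance

/-- The observation state space `ℝᵖ`. -/
abbrev ObsSpace (p : ℕ) : Type := EuclideanSpace ℝ (Fin p)

/-- The canonical space `Ω = Ω^X × Ω^Y` of pairs of càdlàg paths. -/
abbrev PathSpace (S : Type*) [TopologicalSpace S] (p : ℕ) : Type _ :=
  CadlagPath S × CadlagPath (ObsSpace p)

/-- The canonical signal process `X_t(x, y) = x(t)`. -/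
def signal {S : Type*} [TopologicalSpace S] {p : ℕ} (t : ℝ≥0) (ω : PathSpace S p) : S :=
  ω.1.1 t

/-- The canonical observation process `Y_t(x, y) = y(t)`. -/
def observation {S : Type*} [TopologicalSpace S] {p : ℕ} (t : ℝ≥0) (ω : PathSpace S p) :
    ObsSpace p :=
  ω.2.1 t

/-- `𝓕^X = σ{X_t : t ≥ 0}`. -/
@[reducible] def signalSigma (S : Type*) [TopologicalSpace S] [MeasurableSpace S] (p : ℕ) :
    MeasurableSpace (PathSpace S p) :=
  ⨆ t : ℝ≥0, MeasurableSpace.comap (fun ω : PathSpace S p => signal t ω) inferInstance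

/-- `𝓕^Y = σ{Y_t : t ≥ 0}`. -/
@[reducible] def observationSigma (S : Type*) [TopologicalSpace S] (p : ℕ) :
    MeasurableSpace (PathSpace S p) :=
  ⨆ t : ℝ≥0, MeasurableSpace.comap (fun ω : PathSpace S p => observation t ω) inferInstance

/-- `𝓖^h = σ{h(X_t) : t ≥ 0}`. -/
@[reducible] def obsFunctionSigma {S : Type*} [TopologicalSpace S] {p : ℕ} (h : C(S, ObsSpace p)) :
    MeasurableSpace (PathSpace S p) :=
  ⨆ t : ℝ≥0, MeasurableSpace.comap (fun ω : PathSpace S p => h (signal t ω)) inferInstance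

/-- A Feller semigroup of transition probabilities on a (locally compact) space `E`: a family of
Markov kernels satisfying the Chapman–Kolmogorov equations, which maps `C₀(E)` into itself and is
continuous at time zero. -/
structure IsFellerSemigroup {E : Type*} [TopologicalSpace E] [MeasurableSpace E]
    (Q : ℝ≥0 → Kernel E E) : Prop where
  isMarkovKernel : ∀ t, IsMarkovKernel (Q t)
  zero : Q 0 = Kernel.id
  add : ∀ s t, Q (s + t) = Q t ∘ₖ Q s
  map_zeroAtInfty : ∀ (t : ℝ≥0) (f : C₀(E, ℝ)), ∃ g : C₀(E, ℝ), ∀ x, g x = ∫ y, f y ∂(Q t x)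
  tendsto_zero : ∀ (f : C₀(E, ℝ)) (x : E),
    Tendsto (fun t => ∫ y, f y ∂(Q t x)) (𝓝 0) (𝓝 (f x))

/-- Under `P`, the process `Z` is a time-homogeneous Markov process, with respect to the filtration
that it generates, with transition probabilities `Q`. -/
def IsMarkovProcess {Ω E : Type*} [MeasurableSpace Ω] [MeasurableSpace E] (P : Measure Ω)
    (Z : ℝ≥0 → Ω → E) (Q : ℝ≥0 → Kernel E E) : Prop :=
  ∀ (s t : ℝ≥0) (A : Set E), MeasurableSet A →
    P⟦Z (s + t) ⁻¹' A | ⨆ u : Iic s, MeasurableSpace.comap (Z u) inferInstance⟧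
      =ᵐ[P] fun ω => (Q t (Z s ω)).real A

/-- A signal-observation process on `S × ℝᵖ`: the family of laws `𝐏_(x,y)` on the canonical path
space of a Feller–Markov process `(X_t, Y_t)` whose first component is a Feller–Markov process in
its own right. (The conditionally independent increments property of `Y` given `X` is a
consequence of either of the observation models below, so it is not made a field.) -/
structure SignalObservationProcess (S : Type*) [TopologicalSpace S] [MeasurableSpace S]
    (p : ℕ) where
  /-- the transition probabilities of `(X_t, Y_t)` -/
  semigroup : ℝ≥0 → Kernel (S × ObsSpace p) (S × ObsSpace p)
  /-- the transition probabilities of `X_t` -/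
  signalSemigroup : ℝ≥0 → Kernel S S
  /-- the laws `𝐏_(x,y)`, depending measurably on `(x,y)` -/
  law : Kernel (S × ObsSpace p) (PathSpace S p)
  feller : IsFellerSemigroup semigroup
  signal_feller : IsFellerSemigroup signalSemigroup
  isMarkovKernel_law : IsMarkovKernel law
  initial : ∀ z, ∀ᵐ ω ∂(law z), (signal 0 ω, observation 0 ω) = z
  markov : ∀ z, IsMarkovProcess (law z) (fun t ω => (signal t ω, observation t ω)) semigroup
  signal_markov : ∀ z, IsMarkovProcess (law z) signal signalSemigroup

/-- Under `P`, the process `W` is a `p`-dimensional Wiener process with (possibly degenerate)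
covariance matrix `C`. -/
structure IsWienerProcess {Ω : Type*} [MeasurableSpace Ω] {p : ℕ} (P : Measure Ω)
    (W : ℝ≥0 → Ω → ObsSpace p) (C : Matrix (Fin p) (Fin p) ℝ) : Prop where
  zero : ∀ᵐ ω ∂P, W 0 ω = 0
  continuous : ∀ᵐ ω ∂P, Continuous fun t => W t ω
  indepIncrements : HasIndepIncrements W P
  hasLaw : ∀ s t : ℝ≥0, s ≤ t →
    HasLaw (fun ω => W t ω - W s ω) (multivariateGaussian 0 (((t : ℝ) - s) • C)) P

/-- Under `P`, the process `N` is a Poisson process with the deterministic intensity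
`lam ≥ 0`. -/
structure IsPoissonProcess {Ω : Type*} [MeasurableSpace Ω] (P : Measure Ω)
    (N : ℝ≥0 → Ω → ℝ) (lam : ℝ≥0 → ℝ) : Prop where
  zero : ∀ᵐ ω ∂P, N 0 ω = 0
  counting : ∀ᵐ ω ∂P, (Monotone fun t => N t ω) ∧
    ∀ t, (∃ n : ℕ, N t ω = n) ∧ ContinuousWithinAt (fun s => N s ω) (Ici t) t
  indepIncrements : HasIndepIncrements N P
  hasLaw : ∀ s t : ℝ≥0, s ≤ t →
    HasLaw (fun ω => N t ω - N s ω)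
      ((poissonMeasure (∫ u in (s : ℝ)..t, lam u.toNNReal).toNNReal).map (fun n : ℕ => (n : ℝ))) P

/-- `κ` is a regular conditional probability `P(· | m)`. -/
def IsRegularCondProb {Ω : Type*} [mΩ : MeasurableSpace Ω] (P : Measure Ω) (m : MeasurableSpace Ω)
    (κ : Kernel[m, mΩ] Ω Ω) : Prop :=
  (∀ ω, IsProbabilityMeasure (κ ω)) ∧
    ∀ A : Set Ω, MeasurableSet[mΩ] A → (fun ω => (κ ω).real A) =ᵐ[P] P⟦A | m⟧

namespace SignalObservationProcess

variable {S : Type*} [TopologicalSpace S] [MeasurableSpace S] {p : ℕ}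

/-- `𝐏_ν = ∫ 𝐏_(x,y) ν(dx, dy)`. -/
def lawFrom (M : SignalObservationProcess S p) (ν : ProbabilityMeasure (S × ObsSpace p)) :
    Measure (PathSpace S p) :=
  (ν : Measure (S × ObsSpace p)).bind M.law

/-- `𝐏^μ = 𝐏_{μ × δ_0}`. -/
def startLaw (M : SignalObservationProcess S p) (μ : ProbabilityMeasure S) :
    Measure (PathSpace S p) :=
  M.lawFrom ⟨(μ : Measure S).prod (Measure.dirac 0), inferInstance⟩

/-- `μ ∽ ν`: the laws `𝐏^μ` and `𝐏^ν` agree on `𝓕^Y`. -/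
def ObsEquiv (M : SignalObservationProcess S p) (μ ν : ProbabilityMeasure S) : Prop :=
  ∀ A, MeasurableSet[observationSigma S p] A → M.startLaw μ A = M.startLaw ν A

/-- The laws `𝐏^μ` and `𝐏^ν` agree on `𝓖^h = σ{h(X_t) : t ≥ 0}`. -/
def AgreeOnObsFunction (M : SignalObservationProcess S p) (h : C(S, ObsSpace p))
    (μ ν : ProbabilityMeasure S) : Prop :=
  ∀ A, MeasurableSet[obsFunctionSigma h] A → M.startLaw μ A = M.startLaw ν A

/-- The model is observable if `μ ∽ ν` implies `μ = ν`. -/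
def Observable (M : SignalObservationProcess S p) : Prop :=
  ∀ μ ν : ProbabilityMeasure S, M.ObsEquiv μ ν → μ = ν

/-- The space `𝒩` of nonobservable measures. -/
def nonobservable (M : SignalObservationProcess S p) : Set (SignedMeasure S) :=
  {ρ | ∃ (α : ℝ) (μ₁ μ₂ : ProbabilityMeasure S), M.ObsEquiv μ₁ μ₂ ∧
    ρ = α • (μ₁ : Measure S).toSignedMeasure - α • (μ₂ : Measure S).toSignedMeasure}

/-- The space `𝒪` of observable functions. -/
def observableFunctions (M : SignalObservationProcess S p) : Set (S →ᵇ ℝ) :=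
  {f | ∀ μ₁ μ₂ : ProbabilityMeasure S, M.ObsEquiv μ₁ μ₂ →
    ∫ x, f x ∂(μ₁ : Measure S) = ∫ x, f x ∂(μ₂ : Measure S)}

/-- The law, on the product space `(ℝᵖ)^[0,∞)`, of the process `(h(X_t))_{t ≥ 0}` under `𝐏^μ`. -/
def obsFunctionLaw (M : SignalObservationProcess S p) (h : C(S, ObsSpace p))
    (μ : ProbabilityMeasure S) : Measure (ℝ≥0 → ObsSpace p) :=
  (M.startLaw μ).map fun ω t => h (signal t ω)

/-- The noise `Y_t - Y_0 - ∫₀ᵗ h(X_s) ds`, the process written `K B_t`. -/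
def noise (h : C(S, ObsSpace p)) (t : ℝ≥0) (ω : PathSpace S p) : ObsSpace p :=
  observation t ω - observation 0 ω - ∫ s in (0 : ℝ)..t, h (signal s.toNNReal ω)

/-- The white noise type observation model `Y_t = Y_0 + ∫₀ᵗ h(X_s) ds + K B_t`, where, under every
`𝐏_ν`, the process `K B` is a Wiener process with covariance matrix `K K*` that is independent of
`(X, Y_0)`. -/
structure IsWhiteNoise (M : SignalObservationProcess S p) (h : C(S, ObsSpace p)) {q : ℕ}
    (K : Matrix (Fin p) (Fin q) ℝ) : Prop where
  wiener : ∀ ν, IsWienerProcess (M.lawFrom ν) (noise h) (K * K.transpose)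
  indep : ∀ ν, IndepFun (fun (ω : PathSpace S p) (t : ℝ≥0) => noise h t ω)
    (fun ω : PathSpace S p => (ω.1, observation 0 ω)) (M.lawFrom ν)

/-- The process `N_t = Y_t - Y_0`. -/
def count (t : ℝ≥0) (ω : PathSpace S p) : ObsSpace p :=
  observation t ω - observation 0 ω

/-- The counting observation model `Y_t = Y_0 + N_t`, where `h ≥ 0` and `N` is a Cox process with
intensity `h(X_t)`: for every `ν`, under a regular conditional probability `𝐏_ν(· | 𝓕^X)`, the
components `N^i` are independent Poisson processes with intensities `h^i(X_t)` and `N` is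
independent of `Y_0`. -/
structure IsCounting (M : SignalObservationProcess S p) (h : C(S, ObsSpace p)) : Prop where
  nonneg : ∀ x i, 0 ≤ h x i
  cox : ∀ ν, ∃ κ : Kernel[signalSigma S p, inferInstance] (PathSpace S p) (PathSpace S p),
    IsRegularCondProb (M.lawFrom ν) (signalSigma S p) κ ∧
    ∀ᵐ ω ∂(M.lawFrom ν),
      (∀ i, IsPoissonProcess (κ ω) (fun t ω' => count t ω' i) (fun t => h (signal t ω) i)) ∧
      iIndepFun (fun (i : Fin p) (ω' : PathSpace S p) (t : ℝ≥0) => count t ω' i) (κ ω) ∧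
      IndepFun (fun (ω' : PathSpace S p) (t : ℝ≥0) => count t ω')
        (fun ω' : PathSpace S p => observation 0 ω') (κ ω)

end SignalObservationProcess

end

/-! Both relations compare laws of processes. Write Λ_t = ∫₀ᵗ h(X_s) ds. Since h(X) is
right-continuous, it is the right derivative of Λ, so h(X) and Λ generate the same σ-algebra
(`iSup_comap_intervalIntegral`). Under `𝐏^μ` both Y and Λ start at zero almost surely, and the law
of such a process is determined by the joint characteristic functions of its increments
(`agree_on_process_iff`). It remains to see that the laws of Y and Λ determine each other.

White noise: the increments of Y are those of Λ plus an independent Gaussian vector. The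
characteristic function of Y is therefore that of Λ times a Gaussian factor depending only on K and
the times. This factor is an exponential, hence nonzero even when K is degenerate, and it cancels
(`IsWhiteNoise.incrementCharFun_observation`).

Counting: given X, the increments ΔY are independent Poisson variables whose means are the
increments ΔΛ, so E ∏ s^ΔY = E exp(∑ (s - 1) ΔΛ) for complex s, which may differ from factor to
factor. Taking s = exp(il) expresses the characteristic functions of Y through the law of Λ; taking
s = 1 + il expresses those of Λ through the law of Y. In the second case |s| may exceed 1, and
integrability comes from the boundedness of h on the compact space
(`IsCounting.integral_prod_increments`).

The sets 𝒩 and 𝒪 and observability depend on the model only through the relation ∽. -/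

/-! ### Laws of processes and characteristic functions of increments -/

/-- Two measures agree on the σ-algebra generated by a process if and only if the process has the
same law under both of them. -/
theorem agree_on_iSup_comap_iff_map_eq {T Ω E : Type*} [MeasurableSpace Ω] [MeasurableSpace E]
    {Z : T → Ω → E} (hZ : ∀ t, Measurable (Z t)) (P₁ P₂ : Measure Ω) :
    (∀ A, MeasurableSet[⨆ t, MeasurableSpace.comap (Z t) inferInstance] A → P₁ A = P₂ A) ↔
      P₁.map (fun ω t => Z t ω) = P₂.map (fun ω t => Z t ω) := by
  have hm : Measurable fun ω t => Z t ω := measurable_pi_lambda _ hZ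
  have hcomap : (⨆ t, MeasurableSpace.comap (Z t) inferInstance) =
      MeasurableSpace.comap (fun ω t => Z t ω) MeasurableSpace.pi := by
    rw [MeasurableSpace.pi, MeasurableSpace.comap_iSup]
    simp_rw [MeasurableSpace.comap_comp]
    rfl
  rw [hcomap]
  constructor
  · intro h
    ext B hB
    rw [Measure.map_apply hm hB, Measure.map_apply hm hB]
    exact h _ ⟨B, hB, rfl⟩
  · rintro h A ⟨B, hB, rfl⟩
    rw [← Measure.map_apply hm hB, ← Measure.map_apply hm hB, h]

/-- Telescoping. The index `k` enters only through the indicator, so all values are functions of one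
common vector of increments. -/
theorem sum_increments_eq {E : Type*} [AddCommGroup E] (n : ℕ) (z : Fin (n + 1) → E)
    (h0 : z 0 = 0) (k : Fin (n + 1)) :
    z k = ∑ j : Fin n, if j.castSucc < k then z j.succ - z j.castSucc else 0 := by
  induction k using Fin.induction with
  | zero => simp [h0]
  | succ i ih =>
    have : ∀ j : Fin n, (if j.castSucc < i.succ then z j.succ - z j.castSucc else 0) =
        (if j.castSucc < i.castSucc then z j.succ - z j.castSucc else 0) +
          if j = i then z i.succ - z i.castSucc else 0 := by
      intro j
      rcases lt_trichotomy j i with hj | rfl | hj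
      · have h1 : j.castSucc < i.succ := Fin.castSucc_lt_succ_iff.2 hj.le
        have h2 : j.castSucc < i.castSucc := by simpa using hj
        simp [h1, h2, hj.ne]
      · simp
      · have h1 : ¬ j.castSucc < i.succ := by simpa [Fin.castSucc_lt_succ_iff] using hj
        have h2 : ¬ j.castSucc < i.castSucc := by simpa using hj.le
        simp [h1, h2, hj.ne']
    simp_rw [this, Finset.sum_add_distrib, ← ih]
    simp

section

variable {Ω E : Type*} [MeasurableSpace Ω] [NormedAddCommGroup E] [InnerProductSpace ℝ E]
  [FiniteDimensional ℝ E] [MeasurableSpace E] [BorelSpace E]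

/-- The joint law of finitely many vectors is determined by its characteristic function. -/
theorem map_pi_eq_of_charFun {ι : Type*} [Fintype ι] [DecidableEq ι]
    {D : Ω → ι → E} (hD : Measurable D) {P₁ P₂ : Measure Ω}
    [IsFiniteMeasure P₁] [IsFiniteMeasure P₂]
    (h : ∀ l : ι → E, ∫ ω, Complex.exp ((∑ j, inner ℝ (l j) (D ω j) : ℝ) * Complex.I) ∂P₁ =
      ∫ ω, Complex.exp ((∑ j, inner ℝ (l j) (D ω j) : ℝ) * Complex.I) ∂P₂) :
    P₁.map D = P₂.map D := by
  apply Measure.ext_of_charFunDual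
  ext L
  -- A functional on the product is the sum of its restrictions to the coordinates, each of which is
  -- an inner product by Riesz representation.
  have hL : ∀ x : ι → E, L x = ∑ j, inner ℝ
      ((InnerProductSpace.toDual ℝ E).symm (L.comp (ContinuousLinearMap.single ℝ (fun _ : ι => E) j))) (x j) := by
    intro x
    simp only [InnerProductSpace.toDual_symm_apply, ContinuousLinearMap.comp_apply]
    rw [← map_sum]
    congr 1
    ext i
    simp [Finset.sum_apply, Pi.single_apply]
  rw [charFunDual_apply, charFunDual_apply, integral_map hD.aemeasurable (by fun_prop),
    integral_map hD.aemeasurable (by fun_prop)]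
  simp_rw [hL]
  exact h _

/-- The characteristic functions of the increments of a process that starts at zero. -/
noncomputable def incrementCharFun (P : Measure Ω) (Z : ℝ≥0 → Ω → E) {n : ℕ}
    (t : Fin (n + 1) → ℝ≥0) (l : Fin n → E) : ℂ :=
  ∫ ω, Complex.exp
    ((∑ j, inner ℝ (l j) (Z (t j.succ) ω - Z (t j.castSucc) ω) : ℝ) * Complex.I) ∂P

/-- A law on the product space is the projective limit of its finite-dimensional marginals, and each
marginal is the image of a vector of increments under a fixed linear map. -/
theorem map_process_eq_of_incrementCharFun {Z : ℝ≥0 → Ω → E} (hZ : ∀ t, Measurable (Z t))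
    {P₁ P₂ : Measure Ω} [IsFiniteMeasure P₁] [IsFiniteMeasure P₂]
    (h₁ : ∀ᵐ ω ∂P₁, Z 0 ω = 0) (h₂ : ∀ᵐ ω ∂P₂, Z 0 ω = 0)
    (h : ∀ (n : ℕ) (t : Fin (n + 1) → ℝ≥0), Monotone t → ∀ l : Fin n → E,
      incrementCharFun P₁ Z t l = incrementCharFun P₂ Z t l) :
    P₁.map (fun ω t => Z t ω) = P₂.map (fun ω t => Z t ω) := by
  have hm : Measurable fun ω t => Z t ω := measurable_pi_lambda _ hZ
  have hlim := isProjectiveLimit_map (X := Z) (P := P₁) hm.aemeasurable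
  have hlim' := isProjectiveLimit_map (X := Z) (P := P₂) hm.aemeasurable
  refine hlim.unique ?_
  convert hlim' using 1
  funext I
  -- Time 0 is added so that the increments start from a known value, `Z 0 = 0` almost surely.
  set J := insert 0 I with hJ
  obtain ⟨n, hn⟩ : ∃ n, J.card = n + 1 :=
    ⟨J.card - 1, by have := Finset.card_pos.2 (Finset.insert_nonempty 0 I); rw [← hJ] at this; omega⟩
  let t : Fin (n + 1) → ℝ≥0 := J.orderEmbOfFin hn
  have ht : Monotone t := (J.orderEmbOfFin hn).monotone
  have ht0 : t 0 = 0 := by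
    have h0 : (0 : ℝ≥0) ∈ Set.range (J.orderEmbOfFin hn) := by
      rw [Finset.range_orderEmbOfFin]; simp [hJ]
    obtain ⟨k, hk⟩ := h0
    have := ht (Fin.zero_le k)
    exact le_antisymm (this.trans hk.le) zero_le
  have hk : ∀ i : I, ∃ k, t k = i := by
    intro i
    have h0 : (i : ℝ≥0) ∈ Set.range (J.orderEmbOfFin hn) := by
      rw [Finset.range_orderEmbOfFin]; simp [hJ]
    exact h0
  choose k hk using hk
  let D : Ω → Fin n → E := fun ω j => Z (t j.succ) ω - Z (t j.castSucc) ω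
  have hD : Measurable D := measurable_pi_lambda _ fun j => (hZ _).sub (hZ _)
  let g : (Fin n → E) → (I → E) := fun d i => ∑ j : Fin n, if j.castSucc < k i then d j else 0
  have hg : Measurable g := by
    refine measurable_pi_lambda _ fun i => Finset.measurable_sum _ fun j _ => ?_
    split_ifs
    · exact measurable_pi_apply j
    · exact measurable_const
  have key : ∀ ω, Z 0 ω = 0 → I.restrict (Z · ω) = g (D ω) := by
    intro ω hω
    funext i
    simp only [Finset.restrict, g, D]
    rw [← hk i]
    exact sum_increments_eq n (fun k => Z (t k) ω) (by rw [ht0, hω]) (k i)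
  have e₁ : P₁.map (fun ω => I.restrict (Z · ω)) = (P₁.map D).map g := by
    rw [Measure.map_map hg hD]
    exact Measure.map_congr (h₁.mono key)
  have e₂ : P₂.map (fun ω => I.restrict (Z · ω)) = (P₂.map D).map g := by
    rw [Measure.map_map hg hD]
    exact Measure.map_congr (h₂.mono key)
  rw [e₁, e₂, map_pi_eq_of_charFun hD (h n t ht)]

theorem incrementCharFun_eq_of_map_eq {Z : ℝ≥0 → Ω → E} (hZ : ∀ t, Measurable (Z t))
    {P₁ P₂ : Measure Ω}
    (h : P₁.map (fun ω t => Z t ω) = P₂.map (fun ω t => Z t ω)) {n : ℕ}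
    (t : Fin (n + 1) → ℝ≥0) (l : Fin n → E) :
    incrementCharFun P₁ Z t l = incrementCharFun P₂ Z t l := by
  have hm : Measurable fun ω t => Z t ω := measurable_pi_lambda _ hZ
  let F : (ℝ≥0 → E) → ℂ := fun z => Complex.exp
    ((∑ j, inner ℝ (l j) (z (t j.succ) - z (t j.castSucc)) : ℝ) * Complex.I)
  have hF : Measurable F := by fun_prop
  have e : ∀ P : Measure Ω, incrementCharFun P Z t l = ∫ z, F z ∂(P.map fun ω t => Z t ω) := by
    intro P
    rw [integral_map hm.aemeasurable hF.aestronglyMeasurable]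
    rfl
  rw [e, e, h]

/-- Two probability measures agree on the σ-algebra of a process started at zero if and only if the
increments of the process have the same characteristic functions. -/
theorem agree_on_process_iff {Z : ℝ≥0 → Ω → E} (hZ : ∀ t, Measurable (Z t))
    {P₁ P₂ : Measure Ω} [IsFiniteMeasure P₁] [IsFiniteMeasure P₂]
    (h₁ : ∀ᵐ ω ∂P₁, Z 0 ω = 0) (h₂ : ∀ᵐ ω ∂P₂, Z 0 ω = 0) :
    (∀ A, MeasurableSet[⨆ t, MeasurableSpace.comap (Z t) inferInstance] A → P₁ A = P₂ A) ↔
      ∀ (n : ℕ) (t : Fin (n + 1) → ℝ≥0), Monotone t → ∀ l : Fin n → E,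
        incrementCharFun P₁ Z t l = incrementCharFun P₂ Z t l := by
  rw [agree_on_iSup_comap_iff_map_eq hZ]
  exact ⟨fun h n t _ l => incrementCharFun_eq_of_map_eq hZ h t l,
    map_process_eq_of_incrementCharFun hZ h₁ h₂⟩

end

/-! ### Right-continuous processes and their running integrals -/

section Integral

/-- A process with right-continuous paths is jointly measurable. -/
theorem measurable_uncurry_of_rightContinuous {Ω E : Type*} {m : MeasurableSpace Ω}
    [TopologicalSpace E] [TopologicalSpace.PseudoMetrizableSpace E] [MeasurableSpace E]
    [BorelSpace E] {Z : ℝ≥0 → Ω → E} (hZ : ∀ t, Measurable (Z t))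
    (hc : ∀ ω t, ContinuousWithinAt (fun s => Z s ω) (Ici t) t) :
    Measurable fun q : ℝ≥0 × Ω => Z q.1 q.2 := by
  -- `r n s` is the first point of the grid of mesh `1 / (n + 1)` strictly after `s`. It takes
  -- countably many values and tends to `s` from the right, where the paths are continuous.
  let r : ℕ → ℝ≥0 → ℝ≥0 := fun n s => ((⌊((n : ℝ≥0) + 1) * s⌋₊ : ℝ≥0) + 1) / ((n : ℝ≥0) + 1)
  refine measurable_of_tendsto_metrizable (f := fun n q => Z (r n q.1) q.2) (fun n => ?_) ?_
  · have h1 : Measurable fun q : ℕ × Ω => Z (((q.1 : ℝ≥0) + 1) / ((n : ℝ≥0) + 1)) q.2 :=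
      measurable_from_prod_countable_right fun k => hZ (((k : ℝ≥0) + 1) / ((n : ℝ≥0) + 1))
    have h2 : Measurable fun q : ℝ≥0 × Ω => (⌊((n : ℝ≥0) + 1) * q.1⌋₊, q.2) :=
      (Nat.measurable_floor.comp (measurable_fst.const_mul _)).prodMk measurable_snd
    have h3 := h1.comp h2
    simp only [Function.comp_def] at h3
    exact h3
  · rw [tendsto_pi_nhds]
    rintro ⟨s, ω⟩
    refine (hc ω s).tendsto.comp (tendsto_nhdsWithin_iff.2 ⟨?_, Eventually.of_forall fun n => ?_⟩)
    · have hlow : ∀ n, s ≤ r n s := fun n => by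
        rw [le_div_iff₀ (by positivity), mul_comm]
        exact (Nat.lt_floor_add_one _).le
      have hup : ∀ n, r n s ≤ s + 1 / ((n : ℝ≥0) + 1) := fun n => by
        rw [div_le_iff₀ (by positivity), add_mul s, one_div,
          inv_mul_cancel₀ (by positivity), mul_comm s]
        gcongr
        exact Nat.floor_le zero_le
      refine tendsto_of_tendsto_of_tendsto_of_le_of_le tendsto_const_nhds ?_ hlow hup
      simpa using tendsto_const_nhds.add (tendsto_one_div_add_atTop_nhds_zero_nat (𝕜 := ℝ≥0))
    · change s ≤ r n s
      rw [le_div_iff₀ (by positivity), mul_comm]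
      exact (Nat.lt_floor_add_one _).le

theorem measurable_of_rightContinuous {E : Type*}
    [TopologicalSpace E] [TopologicalSpace.PseudoMetrizableSpace E] [MeasurableSpace E]
    [BorelSpace E] {z : ℝ≥0 → E} (hc : ∀ t, ContinuousWithinAt z (Ici t) t) : Measurable z := by
  have h := measurable_uncurry_of_rightContinuous (Ω := Unit) (Z := fun t _ => z t)
    (m := ⊤) (fun _ => measurable_const) (fun _ => hc)
  exact h.comp (measurable_id.prodMk (measurable_const (a := ())))

variable {Ω E : Type*} [NormedAddCommGroup E] [NormedSpace ℝ E] [FiniteDimensional ℝ E]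
  [MeasurableSpace E] [BorelSpace E]

theorem measurable_intervalIntegral_of_rightContinuous {m : MeasurableSpace Ω}
    {Z : ℝ≥0 → Ω → E} (hZ : ∀ t, Measurable (Z t))
    (hc : ∀ ω t, ContinuousWithinAt (fun s => Z s ω) (Ici t) t) (t : ℝ) :
    Measurable fun ω => ∫ s in (0 : ℝ)..t, Z s.toNNReal ω := by
  have : Measurable fun q : Ω × ℝ => Z q.2.toNNReal q.1 :=
    (measurable_uncurry_of_rightContinuous hZ hc).comp
      ((measurable_real_toNNReal.comp measurable_snd).prodMk measurable_fst)
  simp_rw [intervalIntegral]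
  exact (this.stronglyMeasurable.integral_prod_right'.measurable).sub
    this.stronglyMeasurable.integral_prod_right'.measurable

theorem intervalIntegrable_of_rightContinuous {z : ℝ≥0 → E}
    (hc : ∀ t, ContinuousWithinAt z (Ici t) t) {C : ℝ} (hC : ∀ t, ‖z t‖ ≤ C) (a b : ℝ) :
    IntervalIntegrable (fun s : ℝ => z s.toNNReal) volume a b :=
  (intervalIntegrable_const (c := C)).mono_fun
    (((measurable_of_rightContinuous hc).comp measurable_real_toNNReal).aestronglyMeasurable)
    (Eventually.of_forall fun _ => (hC _).trans (le_abs_self C))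

/-- The right derivative of the running integral of a bounded right-continuous path. -/
theorem tendsto_difference_quotient_of_rightContinuous {z : ℝ≥0 → E}
    (hc : ∀ t, ContinuousWithinAt z (Ici t) t) {C : ℝ} (hC : ∀ t, ‖z t‖ ≤ C) (t : ℝ≥0) :
    Tendsto (fun n : ℕ => ((n : ℝ) + 1) •
        ((∫ s in (0 : ℝ)..(t + 1 / ((n : ℝ≥0) + 1) : ℝ≥0), z s.toNNReal) -
          ∫ s in (0 : ℝ)..t, z s.toNNReal)) atTop (𝓝 (z t)) := by
  have hi := intervalIntegrable_of_rightContinuous hc hC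
  have hcw : ContinuousWithinAt (fun s : ℝ => z s.toNNReal) (Ici (t : ℝ)) t := by
    have h1 := hc t
    refine ContinuousWithinAt.comp (t := Ici t) (g := z) (f := Real.toNNReal) (by simpa using h1)
      continuous_real_toNNReal.continuousWithinAt ?_
    intro s hs
    exact NNReal.le_toNNReal_of_coe_le hs
  have hd : HasDerivWithinAt (fun u => ∫ s in (0 : ℝ)..u, z s.toNNReal) (z t) (Ici (t : ℝ)) t := by
    have := intervalIntegral.integral_hasDerivWithinAt_right (hi 0 t) (s := Ici (t : ℝ))
      (t := Ioi (t : ℝ)) (a := 0) ?_ (hcw.mono Ioi_subset_Ici_self)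
    · rwa [Real.toNNReal_coe] at this
    · exact ((measurable_of_rightContinuous hc).comp
        measurable_real_toNNReal).stronglyMeasurable.aestronglyMeasurable.stronglyMeasurableAtFilter
  have hs := hasDerivWithinAt_iff_tendsto_slope.1 hd
  have hn : Tendsto (fun n : ℕ => (t : ℝ) + 1 / ((n : ℝ) + 1)) atTop
      (𝓝[Ici (t : ℝ) \ {(t : ℝ)}] (t : ℝ)) := by
    refine tendsto_nhdsWithin_iff.2 ⟨?_, Eventually.of_forall fun n => ⟨?_, ?_⟩⟩
    · simpa using tendsto_const_nhds.add (tendsto_one_div_add_atTop_nhds_zero_nat (𝕜 := ℝ))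
    · simp only [mem_Ici, le_add_iff_nonneg_right]; positivity
    · have : (0 : ℝ) < 1 / ((n : ℝ) + 1) := by positivity
      simp only [mem_singleton_iff]; linarith
  refine (hs.comp hn).congr fun n => ?_
  simp [slope_def_module]

/-- A bounded process with right-continuous paths generates the same σ-algebra as its running
integral. -/
theorem iSup_comap_intervalIntegral {Z : ℝ≥0 → Ω → E}
    (hc : ∀ ω t, ContinuousWithinAt (fun s => Z s ω) (Ici t) t) {C : ℝ}
    (hC : ∀ t ω, ‖Z t ω‖ ≤ C) :
    (⨆ t : ℝ≥0, MeasurableSpace.comap (Z t) inferInstance) =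
      ⨆ t : ℝ≥0, MeasurableSpace.comap
        (fun ω => ∫ s in (0 : ℝ)..t, Z s.toNNReal ω) inferInstance := by
  apply le_antisymm
  · refine iSup_le fun t => ?_
    rw [← measurable_iff_comap_le]
    have hI : ∀ t : ℝ≥0, Measurable[⨆ t : ℝ≥0, MeasurableSpace.comap
        (fun ω => ∫ s in (0 : ℝ)..t, Z s.toNNReal ω) inferInstance]
        fun ω => ∫ s in (0 : ℝ)..t, Z s.toNNReal ω := fun t =>
      measurable_iff_comap_le.2 (le_iSup (fun t : ℝ≥0 => MeasurableSpace.comap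
        (fun ω => ∫ s in (0 : ℝ)..t, Z s.toNNReal ω) inferInstance) t)
    -- `Z t` is the pointwise limit of difference quotients of the running integral, all measurable
    -- for the σ-algebra of that integral.
    refine @measurable_of_tendsto_metrizable _ _ (_) _ _ _ _ _ _
      (fun n : ℕ => ((hI (t + 1 / ((n : ℝ≥0) + 1))).sub (hI t)).const_smul ((n : ℝ) + 1)) ?_
    rw [tendsto_pi_nhds]
    exact fun ω => tendsto_difference_quotient_of_rightContinuous (hc ω) (fun t => hC t ω) t
  · refine iSup_le fun t => ?_
    rw [← measurable_iff_comap_le]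
    refine measurable_intervalIntegral_of_rightContinuous (fun s => ?_) hc t
    exact measurable_iff_comap_le.2 (le_iSup (fun t => MeasurableSpace.comap (Z t) inferInstance) s)

end Integral

/-! ### Càdlàg paths and the drift -/

theorem CadlagPath.measurable_eval {E : Type*} [TopologicalSpace E] [MeasurableSpace E] (t : ℝ≥0) :
    Measurable fun x : CadlagPath E => x.1 t :=
  measurable_iff_comap_le.2 <|
    le_iSup (fun t : ℝ≥0 => MeasurableSpace.comap (fun x : CadlagPath E => x.1 t) inferInstance) t

section

variable {S : Type*} [TopologicalSpace S] {p : ℕ}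

theorem exists_norm_le [CompactSpace S] (h : C(S, ObsSpace p)) : ∃ C, ∀ x, ‖h x‖ ≤ C := by
  obtain ⟨C, hC⟩ := isCompact_univ.exists_bound_of_continuousOn h.continuous.continuousOn
  exact ⟨C, fun x => hC x (mem_univ x)⟩

theorem CadlagPath.rightContinuous_comp (h : C(S, ObsSpace p)) (x : CadlagPath S) (t : ℝ≥0) :
    ContinuousWithinAt (fun s => h (x.1 s)) (Ici t) t :=
  h.continuous.continuousAt.comp_continuousWithinAt (x.2 t).1

/-- The running integral `∫₀ᵗ h(x_s) ds` of the observation function along a path. -/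
noncomputable def pathDrift (h : C(S, ObsSpace p)) (t : ℝ≥0) (x : CadlagPath S) : ObsSpace p :=
  ∫ s in (0 : ℝ)..t, h (x.1 s.toNNReal)

/-- The drift `∫₀ᵗ h(X_s) ds`. -/
noncomputable def drift (h : C(S, ObsSpace p)) (t : ℝ≥0) (ω : PathSpace S p) : ObsSpace p :=
  pathDrift h t ω.1

theorem drift_zero (h : C(S, ObsSpace p)) (ω : PathSpace S p) : drift h 0 ω = 0 := by
  simp [drift, pathDrift]

theorem intervalIntegrable_signal [CompactSpace S] (h : C(S, ObsSpace p)) (ω : PathSpace S p)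
    (a b : ℝ) : IntervalIntegrable (fun s : ℝ => h (signal s.toNNReal ω)) volume a b := by
  obtain ⟨C, hC⟩ := exists_norm_le h
  exact intervalIntegrable_of_rightContinuous (z := fun s => h (signal s ω))
    (fun t => ω.1.rightContinuous_comp h t) (fun t => hC _) a b

theorem drift_sub_drift_apply [CompactSpace S] (h : C(S, ObsSpace p)) (s t : ℝ≥0)
    (ω : PathSpace S p) (i : Fin p) :
    (drift h t ω - drift h s ω) i = ∫ u in (s : ℝ)..t, h (signal u.toNNReal ω) i := by
  have hi := intervalIntegrable_signal h ω
  change (((∫ u in (0 : ℝ)..t, h (signal u.toNNReal ω)) -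
    ∫ u in (0 : ℝ)..s, h (signal u.toNNReal ω)) i) = _
  rw [intervalIntegral.integral_interval_sub_left (hi 0 t) (hi 0 s)]
  exact ((EuclideanSpace.proj (𝕜 := ℝ) i).intervalIntegral_comp_comm (hi s t)).symm

/-- Compactness bounds `h`, so the constant does not depend on the path. This uniformity makes
exponentials of drift increments integrable in the counting model. -/
theorem abs_drift_sub_drift_apply_le [CompactSpace S] (h : C(S, ObsSpace p)) :
    ∃ C, ∀ (s t : ℝ≥0) (ω : PathSpace S p) (i : Fin p),
      |(drift h t ω - drift h s ω) i| ≤ C * |(t : ℝ) - s| := by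
  obtain ⟨C, hC⟩ := exists_norm_le h
  refine ⟨C, fun s t ω i => ?_⟩
  rw [drift_sub_drift_apply, ← Real.norm_eq_abs]
  exact intervalIntegral.norm_integral_le_of_norm_le_const fun u _ =>
    (PiLp.norm_apply_le _ i).trans (hC _)

theorem obsFunctionSigma_eq [CompactSpace S] (h : C(S, ObsSpace p)) :
    obsFunctionSigma h = ⨆ t : ℝ≥0, MeasurableSpace.comap (drift h t) inferInstance := by
  obtain ⟨C, hC⟩ := exists_norm_le h
  exact iSup_comap_intervalIntegral (Z := fun t (ω : PathSpace S p) => h (signal t ω))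
    (fun ω t => ω.1.rightContinuous_comp h t) (fun t ω => hC _)

variable [MeasurableSpace S]

theorem measurable_observation (t : ℝ≥0) :
    Measurable (observation t : PathSpace S p → ObsSpace p) :=
  (CadlagPath.measurable_eval t).comp measurable_snd

theorem measurable_signal (t : ℝ≥0) : Measurable (signal t : PathSpace S p → S) :=
  (CadlagPath.measurable_eval t).comp measurable_fst

theorem signalSigma_le : signalSigma S p ≤ Prod.instMeasurableSpace :=
  iSup_le fun t => (measurable_signal t).comap_le

theorem measurable_pathDrift [OpensMeasurableSpace S] (h : C(S, ObsSpace p)) (t : ℝ≥0) :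
    Measurable (pathDrift h t) :=
  measurable_intervalIntegral_of_rightContinuous (Z := fun s (x : CadlagPath S) => h (x.1 s))
    (fun s => h.continuous.measurable.comp (CadlagPath.measurable_eval s))
    (fun x s => x.rightContinuous_comp h s) t

theorem measurable_drift [OpensMeasurableSpace S] (h : C(S, ObsSpace p)) (t : ℝ≥0) :
    Measurable (drift h t) :=
  (measurable_pathDrift h t).comp measurable_fst

end

/-! ### The two relations through characteristic functions, and the white noise model -/

namespace SignalObservationProcess

variable {S : Type*} [TopologicalSpace S] [MeasurableSpace S] {p : ℕ}
  (M : SignalObservationProcess S p)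

instance isMarkovKernel : IsMarkovKernel M.law := M.isMarkovKernel_law

instance isProbabilityMeasure_lawFrom (ν : ProbabilityMeasure (S × ObsSpace p)) :
    IsProbabilityMeasure (M.lawFrom ν) := by
  unfold lawFrom; infer_instance

instance isProbabilityMeasure_startLaw (μ : ProbabilityMeasure S) :
    IsProbabilityMeasure (M.startLaw μ) :=
  M.isProbabilityMeasure_lawFrom _

theorem observation_zero_startLaw (μ : ProbabilityMeasure S) :
    ∀ᵐ ω ∂(M.startLaw μ), observation 0 ω = 0 := by
  have hm : MeasurableSet {ω : PathSpace S p | observation 0 ω = 0} :=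
    measurable_observation 0 (measurableSet_singleton 0)
  change ∀ᵐ ω ∂((μ : Measure S).prod (Measure.dirac 0)).bind M.law, observation 0 ω = 0
  rw [Measure.ae_comp_iff hm]
  have h0 : ∀ᵐ z ∂((μ : Measure S).prod (Measure.dirac (0 : ObsSpace p))), z.2 = 0 := by
    have : MeasurableSet {z : S × ObsSpace p | z.2 = 0} :=
      measurable_snd (measurableSet_singleton 0)
    rw [Measure.ae_prod_iff_ae_ae this]
    exact Eventually.of_forall fun x => by simp
  filter_upwards [h0] with z hz
  filter_upwards [M.initial z] with ω hω
  rw [← hz, ← hω]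

theorem obsEquiv_iff (μ ν : ProbabilityMeasure S) :
    M.ObsEquiv μ ν ↔ ∀ (n : ℕ) (t : Fin (n + 1) → ℝ≥0), Monotone t → ∀ l : Fin n → ObsSpace p,
      incrementCharFun (M.startLaw μ) observation t l =
        incrementCharFun (M.startLaw ν) observation t l :=
  agree_on_process_iff measurable_observation (M.observation_zero_startLaw μ)
    (M.observation_zero_startLaw ν)

theorem agreeOnObsFunction_iff [CompactSpace S] [OpensMeasurableSpace S] (h : C(S, ObsSpace p))
    (μ ν : ProbabilityMeasure S) :
    M.AgreeOnObsFunction h μ ν ↔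
      ∀ (n : ℕ) (t : Fin (n + 1) → ℝ≥0), Monotone t → ∀ l : Fin n → ObsSpace p,
        incrementCharFun (M.startLaw μ) (drift h) t l =
          incrementCharFun (M.startLaw ν) (drift h) t l := by
  rw [AgreeOnObsFunction, obsFunctionSigma_eq]
  exact agree_on_process_iff (measurable_drift h) (Eventually.of_forall (drift_zero h))
    (Eventually.of_forall (drift_zero h))

variable {M}

theorem measurable_noise [OpensMeasurableSpace S] (h : C(S, ObsSpace p)) (t : ℝ≥0) :
    Measurable (noise h t : PathSpace S p → ObsSpace p) :=
  ((measurable_observation t).sub (measurable_observation 0)).sub (measurable_drift h t)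

theorem incrementCharFun_of_isWienerProcess {Ω : Type*} [MeasurableSpace Ω] {P : Measure Ω}
    {W : ℝ≥0 → Ω → ObsSpace p} (hm : ∀ t, Measurable (W t)) {C : Matrix (Fin p) (Fin p) ℝ}
    (hW : IsWienerProcess P W C) {n : ℕ} {t : Fin (n + 1) → ℝ≥0} (ht : Monotone t)
    (l : Fin n → ObsSpace p) :
    incrementCharFun P W t l = ∏ j : Fin n,
      charFun (multivariateGaussian 0 (((t j.succ : ℝ) - t j.castSucc) • C)) (l j) := by
  have h1 := (hW.indepIncrements n t ht).integral_fun_prod_comp (𝕜 := ℂ)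
    (f := fun j x => Complex.exp ((inner ℝ (l j) x : ℝ) * Complex.I))
    (fun j => ((hm _).sub (hm _)).aemeasurable)
    (fun j => Measurable.aestronglyMeasurable (by fun_prop))
  unfold incrementCharFun
  push_cast
  simp_rw [Finset.sum_mul, Complex.exp_sum]
  rw [h1]
  refine Finset.prod_congr rfl fun j _ => ?_
  have h2 := (hW.hasLaw (t j.castSucc) (t j.succ) (ht j.castSucc_lt_succ.le)).integral_comp
    (f := fun x => Complex.exp ((inner ℝ (l j) x : ℝ) * Complex.I))
    (Measurable.aestronglyMeasurable (by fun_prop))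
  simp only [Function.comp_def] at h2
  rw [h2, charFun_apply]
  simp_rw [real_inner_comm]

theorem charFun_ne_zero_of_isGaussian {E : Type*} [NormedAddCommGroup E] [InnerProductSpace ℝ E]
    [CompleteSpace E] [SecondCountableTopology E] [MeasurableSpace E] [BorelSpace E]
    (μ : Measure E) [IsGaussian μ] (x : E) : charFun μ x ≠ 0 := by
  rw [IsGaussian.charFun_eq']
  exact Complex.exp_ne_zero _

/-- Noise and signal are independent, so the exponential of the sum of their increments has an
expectation that factors. The Gaussian factor does not involve `μ`. -/
theorem IsWhiteNoise.incrementCharFun_observation [OpensMeasurableSpace S]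
    {h : C(S, ObsSpace p)} {q : ℕ} {K : Matrix (Fin p) (Fin q) ℝ} (hM : M.IsWhiteNoise h K)
    (μ : ProbabilityMeasure S) {n : ℕ} {t : Fin (n + 1) → ℝ≥0} (ht : Monotone t)
    (l : Fin n → ObsSpace p) :
    incrementCharFun (M.startLaw μ) observation t l =
      (∏ j : Fin n, charFun
        (multivariateGaussian 0 (((t j.succ : ℝ) - t j.castSucc) • (K * K.transpose))) (l j)) *
      incrementCharFun (M.startLaw μ) (drift h) t l := by
  rw [← incrementCharFun_of_isWienerProcess (measurable_noise h) (hM.wiener _) ht l]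
  have hind := (hM.indep ⟨(μ : Measure S).prod (Measure.dirac 0), inferInstance⟩)
  have hd := measurable_pathDrift (p := p) h
  have key := hind.integral_fun_comp_mul_comp (𝕜 := ℂ)
    (f := fun w : ℝ≥0 → ObsSpace p => Complex.exp
      ((∑ j, inner ℝ (l j) (w (t j.succ) - w (t j.castSucc)) : ℝ) * Complex.I))
    (g := fun x : CadlagPath S × ObsSpace p => Complex.exp
      ((∑ j, inner ℝ (l j) (pathDrift h (t j.succ) x.1 - pathDrift h (t j.castSucc) x.1) : ℝ) *
        Complex.I))
    (measurable_pi_lambda _ (measurable_noise h)).aemeasurable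
    (measurable_fst.prodMk (measurable_observation 0)).aemeasurable
    (Measurable.aestronglyMeasurable (by fun_prop))
    (Measurable.aestronglyMeasurable (by fun_prop))
  refine Eq.trans ?_ key
  refine integral_congr_ae (Eventually.of_forall fun ω => ?_)
  simp only []
  rw [← Complex.exp_add, ← add_mul, ← Complex.ofReal_add, ← Finset.sum_add_distrib]
  simp_rw [← inner_add_right]
  congr 3
  refine Finset.sum_congr rfl fun j _ => ?_
  congr 1
  -- Each increment of the observation is the noise increment plus the drift increment; the initial
  -- value `observation 0 ω` cancels.
  change _ = (observation _ ω - _ - pathDrift h _ ω.1) - (observation _ ω - _ - pathDrift h _ ω.1)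
    + _
  abel

theorem IsWhiteNoise.obsEquiv_iff [CompactSpace S] [OpensMeasurableSpace S]
    {h : C(S, ObsSpace p)} {q : ℕ} {K : Matrix (Fin p) (Fin q) ℝ} (hM : M.IsWhiteNoise h K)
    (μ ν : ProbabilityMeasure S) : M.ObsEquiv μ ν ↔ M.AgreeOnObsFunction h μ ν := by
  rw [SignalObservationProcess.obsEquiv_iff, agreeOnObsFunction_iff]
  refine forall_congr' fun n => forall_congr' fun t => forall_congr' fun ht =>
    forall_congr' fun l => ?_
  rw [hM.incrementCharFun_observation μ ht, hM.incrementCharFun_observation ν ht]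
  exact mul_right_inj' (Finset.prod_ne_zero_iff.2 fun j _ => charFun_ne_zero_of_isGaussian _ _)

/-- Laws on the product space can be compared between two models, whereas `h` and `h'` may generate
different σ-algebras on the path space. -/
theorem agreeOnObsFunction_iff_obsFunctionLaw_eq [OpensMeasurableSpace S] (h : C(S, ObsSpace p))
    (μ ν : ProbabilityMeasure S) :
    M.AgreeOnObsFunction h μ ν ↔ M.obsFunctionLaw h μ = M.obsFunctionLaw h ν :=
  agree_on_iSup_comap_iff_map_eq
    (fun t => h.continuous.measurable.comp (measurable_signal t)) _ _

theorem nonobservable_eq_of_obsEquiv_iff {r : ProbabilityMeasure S → ProbabilityMeasure S → Prop}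
    (hr : ∀ μ ν, M.ObsEquiv μ ν ↔ r μ ν) :
    M.nonobservable = {ρ : SignedMeasure S | ∃ (α : ℝ) (μ₁ μ₂ : ProbabilityMeasure S),
      r μ₁ μ₂ ∧
      ρ = α • (μ₁ : Measure S).toSignedMeasure - α • (μ₂ : Measure S).toSignedMeasure} := by
  simp only [nonobservable, hr]

theorem observableFunctions_eq_of_obsEquiv_iff {M' : SignalObservationProcess S p}
    (hr : ∀ μ ν, M.ObsEquiv μ ν ↔ M'.ObsEquiv μ ν) :
    M.observableFunctions = M'.observableFunctions := by
  simp only [observableFunctions, hr]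

theorem observable_iff_of_obsEquiv_iff {M' : SignalObservationProcess S p}
    (hr : ∀ μ ν, M.ObsEquiv μ ν ↔ M'.ObsEquiv μ ν) :
    M.Observable ↔ M'.Observable := by
  simp only [Observable, hr]

end SignalObservationProcess

/-! ### Poisson generating functions and the counting model -/

/-- The generating function of the Poisson distribution. -/
theorem integral_pow_poissonMeasure (m : ℝ≥0) (s : ℂ) :
    ∫ n, s ^ n ∂(poissonMeasure m) = Complex.exp (m * (s - 1)) := by
  rw [integral_poissonMeasure]
  have : ∀ n : ℕ, (Real.exp (-m) * (m : ℝ) ^ n / n.factorial) • s ^ n =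
      Complex.exp (-m) * ((m * s) ^ n / n.factorial) := by
    intro n
    rw [Complex.real_smul]
    push_cast
    ring
  simp_rw [this, tsum_mul_left]
  rw [← (NormedSpace.expSeries_div_hasSum_exp ((m : ℂ) * s)).tsum_eq.symm, ← Complex.exp_eq_exp_ℂ,
    ← Complex.exp_add]
  congr 1
  ring

/-- The generating function at the real point `‖s‖`. It controls absolute integrability when `‖s‖ >
1`. -/
theorem integral_norm_pow_poissonMeasure (m : ℝ≥0) (s : ℂ) :
    ∫ n, ‖s ^ n‖ ∂(poissonMeasure m) = Real.exp (m * (‖s‖ - 1)) := by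
  have h := integral_pow_poissonMeasure m (‖s‖ : ℂ)
  have h2 : ∀ n : ℕ, ((‖s‖ : ℂ)) ^ n = ((‖s ^ n‖ : ℝ) : ℂ) := by intro n; simp
  simp_rw [h2] at h
  rw [integral_complex_ofReal] at h
  apply Complex.ofReal_injective
  rw [h]
  push_cast
  rfl

/-- Integration against a regular conditional probability disintegrates the measure. -/
theorem IsRegularCondProb.integral_eq {Ω : Type*} {m : MeasurableSpace Ω}
    [mΩ : MeasurableSpace Ω] {P : Measure Ω} [IsProbabilityMeasure P] (hm : m ≤ mΩ) {κ : Kernel[m, mΩ] Ω Ω}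
    (hκ : IsRegularCondProb P m κ) {F : Ω → ℂ} (hF : Measurable F)
    (h1 : ∀ᵐ ω ∂P, Integrable F (κ ω)) (h2 : Integrable (fun ω => ∫ ω', ‖F ω'‖ ∂(κ ω)) P) :
    ∫ ω, F ω ∂P = ∫ ω, ∫ ω', F ω' ∂(κ ω) ∂P := by
  let κ' : Kernel Ω Ω := ⟨κ, κ.measurable.mono hm le_rfl⟩
  have hprob : ∀ ω, IsProbabilityMeasure (κ' ω) := hκ.1
  -- Averaging the conditional probabilities gives back `P`, because a conditional expectation has
  -- the same integral as the indicator it conditions.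
  have hbind : P.bind κ' = P := by
    ext A hA
    rw [Measure.bind_apply hA κ'.measurable.aemeasurable]
    have hint : Integrable (fun ω => (κ' ω).real A) P :=
      integrable_condExp.congr (hκ.2 A hA).symm
    have e1 : ∫ ω, (κ' ω).real A ∂P = P.real A := by
      have := integral_congr_ae (hκ.2 A hA)
      rw [integral_condExp hm, integral_indicator_const _ hA] at this
      rw [smul_eq_mul, mul_one] at this
      exact this
    have e2 : ∀ ω, κ' ω A = ENNReal.ofReal ((κ' ω).real A) := fun ω => by
      rw [ofReal_measureReal]
    simp_rw [e2]
    rw [← ofReal_integral_eq_lintegral_ofReal hint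
      (Eventually.of_forall fun _ => measureReal_nonneg), e1, ofReal_measureReal]
  have hFint : Integrable F (P.bind κ') :=
    (Measure.integrable_comp_iff hF.aestronglyMeasurable).2 ⟨h1, h2⟩
  conv_lhs => rw [← hbind]
  rw [Measure.comp_eq_comp_const_apply] at hFint ⊢
  rw [Kernel.integral_comp hFint, Kernel.const_apply]
  rfl

namespace SignalObservationProcess

variable {S : Type*} [TopologicalSpace S] [MeasurableSpace S] {p : ℕ}
  {M : SignalObservationProcess S p}

/-- Independent Poisson processes: the expectation of a product of functions of the increments. -/
theorem integral_prod_increments_of_isPoissonProcess {Ω 𝕜 : Type*} [RCLike 𝕜] [MeasurableSpace Ω]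
    {P : Measure Ω} {N : Fin p → ℝ≥0 → Ω → ℝ} (hm : ∀ i t, Measurable (N i t))
    {lam : Fin p → ℝ≥0 → ℝ} (hN : ∀ i, IsPoissonProcess P (N i) (lam i))
    (hind : iIndepFun (fun i ω t => N i t ω) P) {n : ℕ} {t : Fin (n + 1) → ℝ≥0} (ht : Monotone t)
    {φ : Fin n → Fin p → ℝ → 𝕜} (hφ : ∀ j i, Measurable (φ j i)) :
    ∫ ω, ∏ i, ∏ j, φ j i (N i (t j.succ) ω - N i (t j.castSucc) ω) ∂P =
      ∏ i, ∏ j, ∫ k, φ j i (k : ℝ) ∂(poissonMeasure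
        (∫ u in (t j.castSucc : ℝ)..t j.succ, lam i u.toNNReal).toNNReal) := by
  rw [hind.integral_fun_prod_comp (f := fun i w => ∏ j, φ j i (w (t j.succ) - w (t j.castSucc)))
    (fun i => (measurable_pi_lambda _ (hm i)).aemeasurable)
    (fun i => Measurable.aestronglyMeasurable (by fun_prop))]
  refine Finset.prod_congr rfl fun i _ => ?_
  rw [((hN i).indepIncrements n t ht).integral_fun_prod_comp (f := fun j => φ j i)
    (fun j => ((hm i _).sub (hm i _)).aemeasurable)
    (fun j => (hφ j i).aestronglyMeasurable)]
  refine Finset.prod_congr rfl fun j _ => ?_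
  have h2 := ((hN i).hasLaw (t j.castSucc) (t j.succ) (ht j.castSucc_lt_succ.le)).integral_comp
    (f := φ j i) (hφ j i).aestronglyMeasurable
  simp only [Function.comp_def] at h2
  rw [h2, integral_map (by fun_prop) (hφ j i).aestronglyMeasurable]

/-- The conditional expectation given the signal of a product of functions of the increments of the
observations, integrated over the signal. -/
theorem IsCounting.integral_prod_increments [CompactSpace S] [OpensMeasurableSpace S]
    {h : C(S, ObsSpace p)} (hM : M.IsCounting h) (μ : ProbabilityMeasure S)
    {n : ℕ} {t : Fin (n + 1) → ℝ≥0} (ht : Monotone t)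
    {φ : Fin n → Fin p → ℝ → ℂ} (hφ : ∀ j i, Measurable (φ j i))
    {c : Fin n → Fin p → ℂ} {d : Fin n → Fin p → ℝ}
    (hc : ∀ j i (m : ℝ≥0), ∫ k, φ j i (k : ℝ) ∂(poissonMeasure m) = Complex.exp (m * c j i))
    (hd : ∀ j i (m : ℝ≥0), ∫ k, ‖φ j i (k : ℝ)‖ ∂(poissonMeasure m) = Real.exp (m * d j i)) :
    ∫ ω, ∏ i, ∏ j, φ j i ((observation (t j.succ) ω - observation (t j.castSucc) ω) i)
        ∂(M.startLaw μ) =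
      ∫ ω, Complex.exp
        (∑ i, ∑ j, ((drift h (t j.succ) ω - drift h (t j.castSucc) ω) i : ℝ) * c j i)
        ∂(M.startLaw μ) := by
  obtain ⟨κ, hκ, hcox⟩ := hM.cox ⟨(μ : Measure S).prod (Measure.dirac 0), inferInstance⟩
  change ∀ᵐ ω ∂(M.startLaw μ), _ at hcox
  change IsRegularCondProb (M.startLaw μ) _ κ at hκ
  set P := M.startLaw μ
  have hcount : ∀ i t, Measurable fun ω : PathSpace S p => count t ω i := fun i t =>
    (EuclideanSpace.proj (𝕜 := ℝ) i).measurable.comp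
      ((measurable_observation t).sub (measurable_observation 0))
  have hsub : ∀ (s t : ℝ≥0) (ω : PathSpace S p) i,
      (observation t ω - observation s ω) i = count t ω i - count s ω i := by
    intro s t ω i
    simp [count]
  have hnn : ∀ (i : Fin p) (j : Fin n) (ω : PathSpace S p),
      ((∫ u in (t j.castSucc : ℝ)..t j.succ, h (signal u.toNNReal ω) i).toNNReal : ℝ) =
        (drift h (t j.succ) ω - drift h (t j.castSucc) ω) i := by
    intro i j ω
    rw [drift_sub_drift_apply, Real.coe_toNNReal]
    exact intervalIntegral.integral_nonneg (NNReal.coe_le_coe.2 (ht j.castSucc_lt_succ.le))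
      fun u _ => hM.nonneg _ i
  let F : PathSpace S p → ℂ := fun ω =>
    ∏ i, ∏ j, φ j i ((observation (t j.succ) ω - observation (t j.castSucc) ω) i)
  have hF : Measurable F := by
    refine Finset.measurable_prod _ fun i _ => Finset.measurable_prod _ fun j _ =>
      (hφ j i).comp ?_
    simp_rw [hsub]
    exact (hcount i _).sub (hcount i _)
  have hval : ∀ᵐ ω ∂P, ∫ ω', F ω' ∂(κ ω) = Complex.exp
      (∑ i, ∑ j, ((drift h (t j.succ) ω - drift h (t j.castSucc) ω) i : ℝ) * c j i) := by
    filter_upwards [hcox] with ω hω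
    simp only [F, hsub]
    rw [integral_prod_increments_of_isPoissonProcess hcount hω.1 hω.2.1 ht hφ]
    simp_rw [Complex.exp_sum]
    refine Finset.prod_congr rfl fun i _ => Finset.prod_congr rfl fun j _ => ?_
    rw [hc, ← hnn i j ω]
  have hnorm : ∀ᵐ ω ∂P, ∫ ω', ‖F ω'‖ ∂(κ ω) = Real.exp
      (∑ i, ∑ j, (drift h (t j.succ) ω - drift h (t j.castSucc) ω) i * d j i) := by
    filter_upwards [hcox] with ω hω
    simp only [F, hsub, norm_prod]
    rw [integral_prod_increments_of_isPoissonProcess hcount hω.1 hω.2.1 ht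
      (fun j i => (hφ j i).norm)]
    simp_rw [Real.exp_sum]
    refine Finset.prod_congr rfl fun i _ => Finset.prod_congr rfl fun j _ => ?_
    rw [hd, ← hnn i j ω]
  have hFint : ∀ᵐ ω ∂P, Integrable F (κ ω) := by
    filter_upwards [hval] with ω hω
    -- The Bochner integral of a nonintegrable function is 0 by convention, but the value computed
    -- in `hval` is an exponential.
    by_contra hni
    rw [integral_undef hni] at hω
    exact Complex.exp_ne_zero _ hω.symm
  obtain ⟨C, hC⟩ := abs_drift_sub_drift_apply_le h
  have hdrift : ∀ i (t : ℝ≥0), Measurable fun ω : PathSpace S p => drift h t ω i := fun i t =>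
    (EuclideanSpace.proj (𝕜 := ℝ) i).measurable.comp (measurable_drift h t)
  have hFP : Integrable (fun ω => ∫ ω', ‖F ω'‖ ∂(κ ω)) P := by
    refine Integrable.congr ?_ (hnorm.mono fun _ => Eq.symm)
    refine Integrable.of_bound (C := Real.exp (∑ i : Fin p, ∑ j,
      C * |(t j.succ : ℝ) - t j.castSucc| * |d j i|)) ?_ (Eventually.of_forall fun ω => ?_)
    · refine (Real.measurable_exp.comp (Finset.measurable_sum _ fun i _ =>
        Finset.measurable_sum _ fun j _ => ?_)).aestronglyMeasurable
      exact ((hdrift i _).sub (hdrift i _)).mul_const _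
    · rw [Real.norm_eq_abs, Real.abs_exp]
      refine Real.exp_le_exp.2 (Finset.sum_le_sum fun i _ => Finset.sum_le_sum fun j _ => ?_)
      refine (le_abs_self _).trans ?_
      rw [abs_mul]
      exact mul_le_mul_of_nonneg_right (hC _ _ _ _) (abs_nonneg _)
  rw [IsRegularCondProb.integral_eq signalSigma_le hκ hF hFint hFP]
  exact integral_congr_ae hval

/-- The Poisson generating function at `s = exp(il)`, a point of the unit circle, so the integrand
has norm 1 and the norm exponent `d` is 0. -/
theorem IsCounting.incrementCharFun_observation [CompactSpace S] [OpensMeasurableSpace S]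
    {h : C(S, ObsSpace p)} (hM : M.IsCounting h) (μ : ProbabilityMeasure S)
    {n : ℕ} {t : Fin (n + 1) → ℝ≥0} (ht : Monotone t) (l : Fin n → ObsSpace p) :
    incrementCharFun (M.startLaw μ) observation t l =
      ∫ ω, Complex.exp (∑ i, ∑ j, ((drift h (t j.succ) ω - drift h (t j.castSucc) ω) i : ℝ) *
        (Complex.exp (l j i * Complex.I) - 1)) ∂(M.startLaw μ) := by
  rw [← hM.integral_prod_increments μ ht
    (φ := fun j i x => Complex.exp ((l j i : ℂ) * x * Complex.I)) (d := fun _ _ => 0)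
    (fun j i => by fun_prop) (fun j i m => ?_) (fun j i m => ?_)]
  · unfold incrementCharFun
    refine integral_congr_ae (Eventually.of_forall fun ω => ?_)
    simp only []
    simp_rw [← Complex.exp_sum]
    rw [Finset.sum_comm]
    simp only [PiLp.inner_apply, RCLike.inner_apply, conj_trivial]
    push_cast
    simp_rw [Finset.sum_mul]
    congr! 4
    ring
  · have hpow : ∀ k : ℕ, Complex.exp ((l j i : ℂ) * ((k : ℝ) : ℂ) * Complex.I) =
        Complex.exp (l j i * Complex.I) ^ k := by
      intro k
      rw [← Complex.exp_nat_mul]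
      congr 1
      push_cast
      ring
    simp_rw [hpow]
    exact integral_pow_poissonMeasure m _
  · have hone : ∀ k : ℕ, ‖Complex.exp ((l j i : ℂ) * ((k : ℝ) : ℂ) * Complex.I)‖ = 1 := by
      intro k
      rw [← Complex.ofReal_mul, Complex.norm_exp_ofReal_mul_I]
    simp_rw [hone]
    simp

/-- The point `s = 1 + il` is chosen so that `s - 1 = il`: the Poisson average of `s ^ N` is then
exactly the Fourier exponential of the mean. This inverts the passage from intensity to counts. The
floor reads the real-valued count as a natural exponent. -/
theorem IsCounting.incrementCharFun_drift [CompactSpace S] [OpensMeasurableSpace S]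
    {h : C(S, ObsSpace p)} (hM : M.IsCounting h) (μ : ProbabilityMeasure S)
    {n : ℕ} {t : Fin (n + 1) → ℝ≥0} (ht : Monotone t) (l : Fin n → ObsSpace p) :
    incrementCharFun (M.startLaw μ) (drift h) t l =
      ∫ ω, ∏ i, ∏ j, (1 + (l j i : ℂ) * Complex.I) ^
        ⌊(observation (t j.succ) ω - observation (t j.castSucc) ω) i⌋₊ ∂(M.startLaw μ) := by
  rw [hM.integral_prod_increments μ ht
    (φ := fun j i x => (1 + (l j i : ℂ) * Complex.I) ^ ⌊x⌋₊) (c := fun j i => l j i * Complex.I)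
    (d := fun j i => ‖1 + (l j i : ℂ) * Complex.I‖ - 1)
    (fun j i => (measurable_from_nat (f := fun k => (1 + (l j i : ℂ) * Complex.I) ^ k)).comp
      Nat.measurable_floor) (fun j i m => ?_) (fun j i m => ?_)]
  · unfold incrementCharFun
    refine integral_congr_ae (Eventually.of_forall fun ω => ?_)
    simp only []
    rw [Finset.sum_comm]
    simp only [PiLp.inner_apply, RCLike.inner_apply, conj_trivial]
    push_cast
    simp_rw [Finset.sum_mul]
    refine congrArg _ (Finset.sum_congr rfl fun j _ => Finset.sum_congr rfl fun i _ => ?_)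
    ring
  · simp only [Nat.floor_natCast]
    rw [integral_pow_poissonMeasure, add_sub_cancel_left]
  · simp only [Nat.floor_natCast]
    exact integral_norm_pow_poissonMeasure m _

theorem integral_process_congr {Ω E : Type*} [MeasurableSpace Ω] [MeasurableSpace E]
    {Z : ℝ≥0 → Ω → E} (hZ : ∀ t, Measurable (Z t)) {P₁ P₂ : Measure Ω}
    (h : ∀ A, MeasurableSet[⨆ t, MeasurableSpace.comap (Z t) inferInstance] A → P₁ A = P₂ A)
    {F : (ℝ≥0 → E) → ℂ} (hF : Measurable F) :
    ∫ ω, F (fun t => Z t ω) ∂P₁ = ∫ ω, F (fun t => Z t ω) ∂P₂ := by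
  have hm : Measurable fun ω t => Z t ω := measurable_pi_lambda _ hZ
  rw [← integral_map hm.aemeasurable hF.aestronglyMeasurable,
    ← integral_map hm.aemeasurable hF.aestronglyMeasurable,
    (agree_on_iSup_comap_iff_map_eq hZ P₁ P₂).1 h]

/-- Each direction rewrites the characteristic function of one process as the expectation of a
functional of the other that is the same for `μ` and `ν`. -/
theorem IsCounting.obsEquiv_iff [CompactSpace S] [OpensMeasurableSpace S]
    {h : C(S, ObsSpace p)} (hM : M.IsCounting h) (μ ν : ProbabilityMeasure S) :
    M.ObsEquiv μ ν ↔ M.AgreeOnObsFunction h μ ν := by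
  have happly : ∀ (i : Fin p) (s t : ℝ≥0),
      Measurable fun w : ℝ≥0 → ObsSpace p => (w t - w s) i := fun i s t => by
    have hsub : Measurable fun w : ℝ≥0 → ObsSpace p => w t - w s :=
      (measurable_pi_apply t).sub (measurable_pi_apply s)
    exact (EuclideanSpace.proj (𝕜 := ℝ) i).measurable.comp hsub
  constructor
  · intro heq
    rw [agreeOnObsFunction_iff]
    intro n t ht l
    rw [hM.incrementCharFun_drift μ ht, hM.incrementCharFun_drift ν ht]
    refine integral_process_congr (F := fun w => ∏ i, ∏ j, (1 + (l j i : ℂ) * Complex.I) ^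
      ⌊(w (t j.succ) - w (t j.castSucc)) i⌋₊) measurable_observation heq ?_
    exact Finset.measurable_prod _ fun i _ => Finset.measurable_prod _ fun j _ =>
      (measurable_from_nat (f := fun k => (1 + (l j i : ℂ) * Complex.I) ^ k)).comp
        (Nat.measurable_floor.comp (happly i _ _))
  · intro heq
    rw [AgreeOnObsFunction, obsFunctionSigma_eq] at heq
    rw [SignalObservationProcess.obsEquiv_iff]
    intro n t ht l
    rw [hM.incrementCharFun_observation μ ht, hM.incrementCharFun_observation ν ht]
    refine integral_process_congr (F := fun w => Complex.exp (∑ i, ∑ j,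
      ((w (t j.succ) - w (t j.castSucc)) i : ℝ) * (Complex.exp (l j i * Complex.I) - 1)))
      (measurable_drift h) heq ?_
    exact Complex.measurable_exp.comp (Finset.measurable_sum _ fun i _ =>
      Finset.measurable_sum _ fun j _ =>
        (Complex.measurable_ofReal.comp (happly i _ _)).mul_const _)

end SignalObservationProcess

/-! ### The proposition -/

theorem mainTheorem8 {S : Type*} [TopologicalSpace S] [CompactSpace S] [PolishSpace S]
    [MeasurableSpace S] [BorelSpace S] {p : ℕ} :
    -- white noise type observations: the formula for the nonobservable space
    (∀ (M : SignalObservationProcess S p) (h : C(S, ObsSpace p)) (q : ℕ)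
        (K : Matrix (Fin p) (Fin q) ℝ), M.IsWhiteNoise h K →
      (∀ μ₁ μ₂ : ProbabilityMeasure S, M.ObsEquiv μ₁ μ₂ ↔ M.AgreeOnObsFunction h μ₁ μ₂) ∧
      M.nonobservable =
        {ρ : SignedMeasure S | ∃ (α : ℝ) (μ₁ μ₂ : ProbabilityMeasure S),
          M.AgreeOnObsFunction h μ₁ μ₂ ∧
          ρ = α • (μ₁ : Measure S).toSignedMeasure - α • (μ₂ : Measure S).toSignedMeasure}) ∧
    -- observability depends only on the laws of `h(X_t)`, not on the noise covariance
    (∀ (M M' : SignalObservationProcess S p) (h h' : C(S, ObsSpace p)) (q q' : ℕ)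
        (K : Matrix (Fin p) (Fin q) ℝ) (K' : Matrix (Fin p) (Fin q') ℝ),
      M.IsWhiteNoise h K → M'.IsWhiteNoise h' K' →
      (∀ μ : ProbabilityMeasure S, M.obsFunctionLaw h μ = M'.obsFunctionLaw h' μ) →
      (∀ μ₁ μ₂ : ProbabilityMeasure S, M.ObsEquiv μ₁ μ₂ ↔ M'.ObsEquiv μ₁ μ₂) ∧
      M.nonobservable = M'.nonobservable ∧
      M.observableFunctions = M'.observableFunctions ∧
      (M.Observable ↔ M'.Observable)) ∧
    -- counting observations
    (∀ (M : SignalObservationProcess S p) (h : C(S, ObsSpace p)), M.IsCounting h →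
      (∀ μ₁ μ₂ : ProbabilityMeasure S, M.ObsEquiv μ₁ μ₂ ↔ M.AgreeOnObsFunction h μ₁ μ₂) ∧
      M.nonobservable =
        {ρ : SignedMeasure S | ∃ (α : ℝ) (μ₁ μ₂ : ProbabilityMeasure S),
          M.AgreeOnObsFunction h μ₁ μ₂ ∧
          ρ = α • (μ₁ : Measure S).toSignedMeasure - α • (μ₂ : Measure S).toSignedMeasure}) := by
  refine ⟨fun M h q K hM => ⟨hM.obsEquiv_iff,
    SignalObservationProcess.nonobservable_eq_of_obsEquiv_iff hM.obsEquiv_iff⟩,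
    fun M M' h h' q q' K K' hM hM' hlaw => ?_,
    fun M h hM => ⟨hM.obsEquiv_iff,
      SignalObservationProcess.nonobservable_eq_of_obsEquiv_iff hM.obsEquiv_iff⟩⟩
  have heq : ∀ μ ν : ProbabilityMeasure S, M.ObsEquiv μ ν ↔ M'.ObsEquiv μ ν := fun μ ν => by
    rw [hM.obsEquiv_iff, hM'.obsEquiv_iff,
      SignalObservationProcess.agreeOnObsFunction_iff_obsFunctionLaw_eq,
      SignalObservationProcess.agreeOnObsFunction_iff_obsFunctionLaw_eq, hlaw, hlaw]
  exact ⟨heq, SignalObservationProcess.nonobservable_eq_of_obsEquiv_iff heq,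
    SignalObservationProcess.observableFunctions_eq_of_obsEquiv_iff heq,
    SignalObservationProcess.observable_iff_of_obsEquiv_iff heq⟩
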